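/- Let $f:\mathbb{R}^d\to\mathbb{R}$ be twice differentiable, with gradient $g(x)=\nabla f(x)$ and Hessian $H(x)=\nabla^2 f(x)$; $\|\cdot\|$ is the Euclidean norm of vectors and the spectral norm of matrices, and $A^\dagger$ is the Moore–Penrose inverse. Suppose there are constants $\gamma>0$ and $0<\nu\le 1$ such that for all $x\in\mathbb{R}^d$ - $\|H(x)p\|\ge\gamma\|p\|$ for all $p\in\mathrm{Range}(H(x))$, and - $\|U_\perp^{\top}g(x)\|^2\le\frac{1-\nu}{\nu}\|U^{\top}g(x)\|^2$, where the columns of $U$ and $U_\perp$ are orthonormal bases of $\mathrm{Range}(H(x))$ and of its orthogonal complement. Let $x_k\in\mathbb{R}^d$, $g_k=g(x_k)$, $H_k=H(x_k)$, and let $\tilde H_k=H_k+E_k$ with $E_k$ symmetric, $\|E_k\|\le\varepsilon$, $0<\varepsilon<\gamma$, and $\|\tilde H_k^\dagger\|\le C/\varepsilon$ for a constant $C\ge 1$. For $1\le t\le\mathrm{rank}(\tilde H_k)$ let $$p_k^{(t)}=\operatorname{argmin}\ \|p\|^2\quad\text{subject to}\quad p\in\operatorname{Argmin}_{\hat p\in\mathcal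 K_t}\|\tilde H_k\hat p+g_k\|^2$$ be the $t$-th MINRES-QLP iterate, where $\mathcal K_t$ is a range-invariant Krylov subspace: either $\mathcal K_t=\mathcal K_t(\tilde H_k,g_k)$, allowed if $g_k\in\mathrm{Range}(\tilde H_k)$, or $\mathcal K_t=\mathcal K_t(\tilde H_k,\tilde H_kg_k)$, always allowed. Here $\mathcal K_t(A,b)=\mathrm{span}\{b,Ab,\dots,A^{t-1}b\}$. Then $$\|p_k^{(t)}\|\le\frac1{\tilde\gamma}\|g_k\|,\qquad t=1,2,\dots,\mathrm{rank}(\tilde H_k),$$ where $$\tilde\gamma=\left(\frac1{\gamma-\varepsilon}+C\left(\frac2\gamma+\frac{\sqrt{1-\nu}}{\varepsilon}\right)\right)^{-1}.$$ If moreover $\mathrm{rank}(H_k)=\mathrm{rank}(\tilde H_k)$ (acute perturbation), the same bound holds with $\tilde\gamma=\gamma-\varepsilon$. -/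

import Mathlib

open scoped Gradient

noncomputable section

namespace NewtonMR

/-- The space `ℝ^d` with its Euclidean norm. -/
abbrev Vec (d : ℕ) : Type := EuclideanSpace ℝ (Fin d)

/-- Real `d × d` matrices, as operators on `ℝ^d`; the norm is the spectral norm. -/
abbrev Op (d : ℕ) : Type := Vec d →L[ℝ] Vec d

/-- `Range(A)`. -/
def rangeOf {d : ℕ} (A : Op d) : Submodule ℝ (Vec d) := LinearMap.range A.toLinearMap

/-- `Null(A)`. -/
def nullOf {d : ℕ} (A : Op d) : Submodule ℝ (Vec d) := LinearMap.ker A.toLinearMap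

/-- `rank(A)`. -/
def rankOf {d : ℕ} (A : Op d) : ℕ := Module.finrank ℝ (rangeOf A)

/-- The Moore–Penrose generalized inverse `A†`: project orthogonally onto `Range(A)`, then
invert the bijection `Null(A)ᗮ → Range(A)` induced by `A`. -/
def pinv {d : ℕ} (A : Op d) : Op d :=
  LinearMap.toContinuousLinearMap
    ((nullOf A)ᗮ.subtype ∘ₗ
      (A.toLinearMap.kerComplementEquivRange
        (Submodule.isCompl_orthogonal
          (K := nullOf A)).symm).symm.toLinearMap ∘ₗ
      (rangeOf A).orthogonalProjectionOnto.toLinearMap)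

/-- `A A†` is the orthogonal projector onto `Range(A)`. -/
theorem apply_pinv {d : ℕ} (A : Op d) (y : Vec d) : A (pinv A y) = (rangeOf A).starProjection y := by
  have h := (A.toLinearMap.kerComplementEquivRange
        (Submodule.isCompl_orthogonal
          (K := nullOf A)).symm).apply_symm_apply ((rangeOf A).orthogonalProjectionOnto y)
  exact congrArg Subtype.val h

/-- `A† A` is the orthogonal projector onto `Null(A)ᗮ`. -/
theorem pinv_apply {d : ℕ} (A : Op d) (y : Vec d) : pinv A (A y) = (nullOf A)ᗮ.starProjection y := by
  have hm : pinv A (A y) ∈ (nullOf A)ᗮ := by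
    simp only [pinv]; exact Subtype.property _
  have hk : y - pinv A (A y) ∈ nullOf A := by
    have h := apply_pinv A (A y)
    have : (rangeOf A).starProjection (A y) = A y :=
      Submodule.starProjection_eq_self_iff.2 ⟨y, rfl⟩
    show A _ = 0
    rw [map_sub, h, this, sub_self]
  symm
  apply Submodule.eq_starProjection_of_mem_of_inner_eq_zero hm
  intro w hw
  exact (Submodule.mem_orthogonal _ _).1 hw _ hk

/-- `f` is twice differentiable: `f` and its gradient are differentiable everywhere. -/
def TwiceDifferentiable {d : ℕ} (f : Vec d → ℝ) : Prop :=
  Differentiable ℝ f ∧ Differentiable ℝ (∇ f)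

/-- The Hessian `H(x)`, the derivative of the gradient at `x`. -/
def hessian {d : ℕ} (f : Vec d → ℝ) (x : Vec d) : Op d := fderiv ℝ (∇ f) x

/-- Pseudo-inverse regularity with constant `γ`. -/
def PseudoInverseRegular {d : ℕ} (f : Vec d → ℝ) (γ : ℝ) : Prop :=
  ∀ x : Vec d, ∀ p ∈ rangeOf (hessian f x), γ * ‖p‖ ≤ ‖hessian f x p‖

/-- The gradient–Hessian null-space property with constant `ν`. For orthonormal bases `U`, `U⊥` of
a subspace `S` and of `Sᗮ`, the norms `‖Uᵀ g‖`, `‖U⊥ᵀ g‖` are the norms of the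
orthogonal projections of `g` onto `S`, `Sᗮ`. -/
def GradientHessianNullSpace {d : ℕ} (f : Vec d → ℝ) (ν : ℝ) : Prop :=
  ∀ x : Vec d,
    ‖(rangeOf (hessian f x))ᗮ.orthogonalProjectionOnto (∇ f x)‖ ^ 2 ≤
      ((1 - ν) / ν) * ‖(rangeOf (hessian f x)).orthogonalProjectionOnto (∇ f x)‖ ^ 2

/-- The Krylov subspace `K_t(A, b) = span {b, A b, …, A^(t-1) b}`. -/
def krylov {d : ℕ} (A : Op d) (b : Vec d) (t : ℕ) : Submodule ℝ (Vec d) :=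
  Submodule.span ℝ {v | ∃ i < t, v = (A ^ i) b}

/-- `K` is a range-invariant Krylov subspace of order `t` for `(A, b)`: either
`K_t(A, b)` in the case `b ∈ Range(A)`, or `K_t(A, A b)` (with no condition on `b`). -/
def IsRangeInvariantKrylov {d : ℕ} (A : Op d) (b : Vec d) (t : ℕ)
    (K : Submodule ℝ (Vec d)) : Prop :=
  (b ∈ rangeOf A ∧ K = krylov A b t) ∨ K = krylov A (A b) t

/-- `Argmin_{q ∈ K} ‖A q + g‖²`. -/
def lsArgmin {d : ℕ} (A : Op d) (g : Vec d) (K : Submodule ℝ (Vec d)) : Set (Vec d) :=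
  {p | p ∈ K ∧ ∀ q ∈ K, ‖A p + g‖ ^ 2 ≤ ‖A q + g‖ ^ 2}

/-- `p` is the MINRES-QLP iterate for the system `A p = -g` over the Krylov subspace `K`:
`p = argmin ‖p‖²` subject to `p ∈ Argmin_{q ∈ K} ‖A q + g‖²`. -/
def IsMinresQLPIterate {d : ℕ} (A : Op d) (g : Vec d) (K : Submodule ℝ (Vec d))
    (p : Vec d) : Prop :=
  p ∈ lsArgmin A g K ∧ ∀ q ∈ lsArgmin A g K, ‖p‖ ^ 2 ≤ ‖q‖ ^ 2

/-- The MINRES-QLP iterate exists over every subspace. -/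
theorem exists_isMinresQLPIterate {d : ℕ} (A : Op d) (g : Vec d) (K : Submodule ℝ (Vec d)) :
    ∃ p, IsMinresQLPIterate A g K p := by
  let L := K.map A.toLinearMap
  obtain ⟨p0, hp0, hp0'⟩ : L.starProjection (-g) ∈ L := L.starProjection_apply_mem _
  have hmin : ∀ q ∈ K, ‖A p0 + g‖ ≤ ‖A q + g‖ := by
    intro q hq
    have h := Submodule.starProjection_minimal (U := L) (-g)
    have hb : BddBelow (Set.range fun w : L => ‖-g - (w : Vec d)‖) :=
      ⟨0, by rintro _ ⟨w, rfl⟩; positivity⟩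
    have h2 := ciInf_le hb ⟨A q, q, hq, rfl⟩
    rw [← h, ← hp0'] at h2
    have e : ∀ z : Vec d, ‖-g - z‖ = ‖z + g‖ := fun z => by rw [← norm_neg]; congr 1; abel
    simpa [e] using h2
  have hne : p0 ∈ lsArgmin A g K := ⟨hp0, fun q hq => by have := hmin q hq; gcongr⟩
  have hclosed : IsClosed (lsArgmin A g K) := by
    have : lsArgmin A g K =
        (K : Set (Vec d)) ∩ ⋂ q ∈ K, {p | ‖A p + g‖ ^ 2 ≤ ‖A q + g‖ ^ 2} := by
      ext p; simp [lsArgmin]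
    rw [this]
    exact K.closed_of_finiteDimensional.inter
      (isClosed_biInter fun q _ => isClosed_le (by fun_prop) (by fun_prop))
  obtain ⟨p, hp, h⟩ := hclosed.exists_infDist_eq_dist ⟨p0, hne⟩ 0
  refine ⟨p, hp, fun q hq => ?_⟩
  have := Metric.infDist_le_dist_of_mem (x := (0 : Vec d)) hq
  rw [h] at this
  simp only [dist_zero_left] at this
  gcongr

/-- The constant `γ̃` for a general perturbation. -/
def gammaTilde (γ ν ε C : ℝ) : ℝ :=
  (1 / (γ - ε) + C * (2 / γ + Real.sqrt (1 - ν) / ε))⁻¹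

/-- The constant `γ̃` for an acute (rank preserving) perturbation. -/
def gammaTildeAcute (γ ε : ℝ) : ℝ := γ - ε

end NewtonMR

end

/-!
The perturbed Hessian `A` is symmetric, so everything happens in the coordinates of an orthonormal
eigenbasis, with eigenvalues `λ`. With `M = C / ε`, the pseudo-inverse bound says `1 ≤ M |λ|` on
the nonzero eigenvalues.

The heart is `norm_le_of_eq_add_apply`: whenever `g = a + A w`, every iterate satisfies
`‖p‖ ≤ M ‖a‖ + 2 ‖w‖`. Splitting `g` into its part `n` orthogonal to `Range(H)` and `H w`, the
null-space property bounds `‖n‖`, regularity bounds `‖w‖ ≤ ‖g‖ / γ`, and `H w = A w - E w` gives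
the first bound of the theorem with `a = n - E w`. The second bound needs only that the nonzero
eigenvalues of `A` have modulus at least `γ - ε` when the rank is preserved
(`le_abs_eigenVal_of_rank_eq`), because `‖A p‖ ≤ ‖g‖`.

To prove `norm_le_of_eq_add_apply`, write `q = -p`. Optimising the weight `m` in
`le_of_forall_weighted_sq_le` reduces it to
`‖q‖² ≤ (M² m² + 4) ∑ g² / (m² + λ²)` for every `m > 0`. The residual is `r = φ(λ) g` for a
polynomial `φ` with `φ(0) = 1`, orthogonal to the image of the Krylov subspace. Orthogonality forces
`φ` to be real-rooted (`im_eq_zero_or_residual_eq_zero`), so `φ = ∏ (1 - ζ X)`.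

* Over `span {g, A g, …}` one even has `‖q‖² ≤ ∑ g² / λ²`: orthogonality turns the difference of
  the two sides into a sum of squares plus `(∑ ζ²) ‖r‖²`.
* Over `span {A g, A² g, …}` also `φ'(0) = 0`, that is `∑ ζ = 0`, and the iterate may be longer than
  `g / λ`. Put `P = ∑ ζ²`. If `P m² ≤ 2`, the same computation leaves an error governed by
  `|∑ ζ³| ≤ P ^ (3/2)`, which the weight absorbs pointwise. If `P m² ≥ 2`, then
  `|φ(i m)|² = ∏ (1 + m² ζ²) ≥ 3`, and comparing `φ` with its value at `i m` (division by
  `X² + m²`) expresses `∑ λ² h r / (m² + λ²)`, where `h = A q`, through sums that are again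
  controlled pointwise.
-/

namespace NewtonMR

open Polynomial

/-! ### Real-rooted polynomials with constant coefficient one -/

/-- The polynomial `∏ (1 - ζ X)`, normalised to have constant coefficient `1`; the `ζ` are the
inverses of its roots. -/
noncomputable def invRootProd (Z : Multiset ℝ) : ℝ[X] := (Z.map fun ζ => 1 - C ζ * X).prod

/-- The power sum `∑ ζ ^ k`. -/
noncomputable def powerSum (k : ℕ) (Z : Multiset ℝ) : ℝ := (Z.map fun ζ => ζ ^ k).sum

@[simp] lemma invRootProd_zero : invRootProd 0 = 1 := by simp [invRootProd]

@[simp] lemma invRootProd_cons (ζ : ℝ) (Z : Multiset ℝ) :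
    invRootProd (ζ ::ₘ Z) = (1 - C ζ * X) * invRootProd Z := by simp [invRootProd]

@[simp] lemma powerSum_zero (k : ℕ) : powerSum k 0 = 0 := by simp [powerSum]

@[simp] lemma powerSum_cons (k : ℕ) (ζ : ℝ) (Z : Multiset ℝ) :
    powerSum k (ζ ::ₘ Z) = ζ ^ k + powerSum k Z := by simp [powerSum]

lemma exists_eq_invRootProd (n : ℕ) : ∀ p : ℝ[X], p.natDegree = n → p.coeff 0 = 1 →
    (∀ z : ℂ, aeval z p = 0 → z.im = 0) → ∃ Z : Multiset ℝ, p = invRootProd Z := by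
  induction n with
  | zero =>
    intro p hn h0 _
    refine ⟨0, ?_⟩
    rw [eq_C_of_natDegree_eq_zero hn, h0]
    simp
  | succ n ih =>
    intro p hn h0 hz
    have hp0 : p ≠ 0 := by rintro rfl; simp at h0
    have hdeg : p.degree ≠ 0 := by
      rw [degree_eq_natDegree hp0, hn]; exact_mod_cast Nat.succ_ne_zero n
    obtain ⟨z, hzr⟩ := IsAlgClosed.exists_aeval_eq_zero ℂ p hdeg
    have him := hz z hzr
    obtain ⟨x, rfl⟩ : ∃ x : ℝ, (x : ℂ) = z := ⟨z.re, Complex.ext rfl (by simp [him])⟩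
    have hx : p.IsRoot x := by
      have h := Polynomial.aeval_algebraMap_apply ℂ x p
      rw [show (algebraMap ℝ ℂ x) = (x : ℂ) from rfl, hzr] at h
      have h' : aeval x p = 0 := by
        apply (algebraMap ℝ ℂ).injective; rw [← h, map_zero]
      simpa [IsRoot] using h'
    obtain ⟨q, hq⟩ := dvd_iff_isRoot.2 hx
    have hq0 : q ≠ 0 := by rintro rfl; simp [hq] at hp0
    have hc : (-x) * q.coeff 0 = 1 := by rw [← h0, hq, mul_coeff_zero]; simp
    have hx0 : x ≠ 0 := by rintro rfl; simp at hc
    have hqn : q.natDegree = n := by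
      have := natDegree_mul (X_sub_C_ne_zero x) hq0
      rw [← hq, hn, natDegree_X_sub_C] at this
      omega
    obtain ⟨Z, hZ⟩ := ih (C (-x) * q) (by rw [natDegree_C_mul (neg_ne_zero.2 hx0), hqn])
      (by simpa using hc) (fun z hzq => hz z (by
        rw [map_mul, mul_eq_zero] at hzq
        rw [hq, map_mul, mul_eq_zero]
        rcases hzq with h | h
        · simp [hx0] at h
        · exact Or.inr h))
    refine ⟨x⁻¹ ::ₘ Z, ?_⟩
    have e : (1 - C x⁻¹ * X) * C (-x) = X - C x := by
      rw [sub_mul, one_mul, mul_right_comm, ← C_mul, mul_neg, inv_mul_cancel₀ hx0]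
      simp [neg_add_eq_sub]
    rw [invRootProd_cons, ← hZ, ← mul_assoc, e, hq]

/-- Newton's identities for the four lowest coefficients. -/
lemma coeff_invRootProd (Z : Multiset ℝ) :
    (invRootProd Z).coeff 0 = 1 ∧ (invRootProd Z).coeff 1 = -powerSum 1 Z ∧
    (invRootProd Z).coeff 2 = (powerSum 1 Z ^ 2 - powerSum 2 Z) / 2 ∧
    (invRootProd Z).coeff 3 =
      -(powerSum 1 Z ^ 3 - 3 * powerSum 1 Z * powerSum 2 Z + 2 * powerSum 3 Z) / 6 := by
  induction Z using Multiset.induction_on with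
  | empty => simp [coeff_one]
  | cons ζ Z ih =>
    obtain ⟨h0, h1, h2, h3⟩ := ih
    have e : ∀ k, (invRootProd (ζ ::ₘ Z)).coeff (k + 1) =
        (invRootProd Z).coeff (k + 1) - ζ * (invRootProd Z).coeff k := by
      intro k
      rw [invRootProd_cons, sub_mul, one_mul, coeff_sub, mul_assoc, coeff_C_mul, coeff_X_mul]
    refine ⟨by simp [h0, mul_coeff_zero], ?_, ?_, ?_⟩
    · rw [e 0, h0, h1]; simp; ring
    · rw [e 1, h2, h1]; simp; ring
    · rw [e 2, h3, h2]; simp; ring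

lemma powerSum_two_nonneg (Z : Multiset ℝ) : 0 ≤ powerSum 2 Z := by
  induction Z using Multiset.induction_on with
  | empty => simp
  | cons ζ Z ih => rw [powerSum_cons]; positivity

lemma abs_powerSum_three_le (Z : Multiset ℝ) (b : ℝ) (hb : 0 ≤ b) (h : powerSum 2 Z ≤ b ^ 2) :
    |powerSum 3 Z| ≤ b * powerSum 2 Z := by
  induction Z using Multiset.induction_on with
  | empty => simp
  | cons ζ Z ih =>
    rw [powerSum_cons] at h
    have h2 := powerSum_two_nonneg Z
    have h3 := ih (by nlinarith [sq_nonneg ζ])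
    have hζ : |ζ| ≤ b := abs_le_of_sq_le_sq (by linarith) hb
    rw [powerSum_cons, powerSum_cons]
    calc |ζ ^ 3 + powerSum 3 Z| ≤ |ζ ^ 3| + |powerSum 3 Z| := abs_add_le _ _
      _ ≤ b * ζ ^ 2 + b * powerSum 2 Z := by
        gcongr
        rw [pow_succ, mul_comm, abs_mul, abs_of_nonneg (sq_nonneg ζ)]
        gcongr
      _ = _ := by ring

/-- At a purely imaginary point `i m` every factor has squared modulus `1 + m² ζ²`. -/
lemma le_normSq_aeval_invRootProd (Z : Multiset ℝ) (m : ℝ) :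
    1 + m ^ 2 * powerSum 2 Z ≤ Complex.normSq (aeval (m * Complex.I : ℂ) (invRootProd Z)) := by
  induction Z using Multiset.induction_on with
  | empty => simp
  | cons ζ Z ih =>
    have h2 := powerSum_two_nonneg Z
    rw [invRootProd_cons, map_mul, map_mul, powerSum_cons]
    have e : Complex.normSq (aeval (m * Complex.I : ℂ) (1 - C ζ * X : ℝ[X])) =
        1 + m ^ 2 * ζ ^ 2 := by
      simp [Complex.normSq_apply]; ring
    rw [e]
    have : (1 + m ^ 2 * ζ ^ 2) * (1 + m ^ 2 * powerSum 2 Z) ≤ (1 + m ^ 2 * ζ ^ 2) *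
      Complex.normSq (aeval (m * Complex.I : ℂ) (invRootProd Z)) := by gcongr
    have h4 : 0 ≤ (m ^ 2 * ζ ^ 2) * (m ^ 2 * powerSum 2 Z) := by positivity
    nlinarith

/-- Division with remainder of `p` by `X² + m²`; the remainder is read off from `p (i m)`. -/
lemma exists_eq_add_sq_add_mul (p : ℝ[X]) (m : ℝ) :
    ∃ (a b : ℝ) (q : ℝ[X]), p = C a + C b * X + (X ^ 2 + C (m ^ 2)) * q ∧
      (∀ n : ℕ, p.degree < (n + 2 : ℕ) → q.degree < n) ∧
      Complex.normSq (aeval (m * Complex.I : ℂ) p) = a ^ 2 + m ^ 2 * b ^ 2 := by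
  have hmon : (X ^ 2 + C (m ^ 2) : ℝ[X]).Monic := monic_X_pow_add_C _ (by norm_num)
  have hdeg : (X ^ 2 + C (m ^ 2) : ℝ[X]).degree = 2 := degree_X_pow_add_C (by norm_num) _
  have h := modByMonic_add_div p (X ^ 2 + C (m ^ 2))
  set r := p %ₘ (X ^ 2 + C (m ^ 2)) with hr
  set q := p /ₘ (X ^ 2 + C (m ^ 2)) with hq
  have hrd : r.degree < 2 := hdeg ▸ degree_modByMonic_lt p hmon
  have hr1 : r = C (r.coeff 0) + C (r.coeff 1) * X := by
    have : r.degree ≤ 1 := Order.le_of_lt_succ hrd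
    rw [add_comm]; exact eq_X_add_C_of_degree_le_one this
  refine ⟨r.coeff 0, r.coeff 1, q, by rw [← hr1, h], ?_, ?_⟩
  · intro n hn
    by_contra hcon
    push Not at hcon
    have hqd : p.degree = 2 + q.degree := by
      rw [← h, degree_add_eq_right_of_degree_lt, degree_mul, hdeg]
      rw [degree_mul, hdeg]
      have hq0 : (0 : WithBot ℕ) ≤ q.degree := le_trans (by exact_mod_cast Nat.zero_le n) hcon
      calc r.degree < 2 := hrd
        _ = 2 + 0 := by simp
        _ ≤ 2 + q.degree := by gcongr
    rw [hqd] at hn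
    have : ((n + 2 : ℕ) : WithBot ℕ) ≤ 2 + q.degree := by
      push_cast; rw [add_comm]; gcongr
    exact absurd hn (not_lt.2 this)
  · rw [← h, hr1]
    have : aeval (m * Complex.I : ℂ) (X ^ 2 + C (m ^ 2) : ℝ[X]) = 0 := by
      simp [mul_pow]
    rw [map_add, map_mul, this]
    simp [Complex.normSq_apply]; ring

/-! ### Residual polynomials -/

section Residual

variable {ι : Type*} {s : Finset ι} {l g : ι → ℝ}

/-- A residual polynomial has only real roots: a pair of conjugate nonreal roots would be the
roots of a positive quadratic factor, and orthogonality to the cofactor would force a vanishing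
residual. -/
lemma im_eq_zero_or_residual_eq_zero (hl : ∀ i ∈ s, l i ≠ 0) {φ : ℝ[X]}
    (orth : ∀ χ : ℝ[X], χ.degree + 2 = φ.degree →
      ∑ i ∈ s, l i ^ 2 * χ.eval (l i) * φ.eval (l i) * g i ^ 2 = 0) :
    (∀ z : ℂ, aeval z φ = 0 → z.im = 0) ∨ ∀ i ∈ s, φ.eval (l i) * g i = 0 := by
  by_contra! hcon
  obtain ⟨⟨z, hz, him⟩, j, hj, hne⟩ := hcon
  obtain ⟨χ, hχ⟩ := quadratic_dvd_of_aeval_eq_zero_im_ne_zero φ hz him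
  set Q : ℝ[X] := X ^ 2 - C (2 * z.re) * X + C (‖z‖ ^ 2) with hQ
  have hQd : Q.degree = 2 := by
    have e : Q = C 1 * X ^ 2 + C (-(2 * z.re)) * X + C (‖z‖ ^ 2) := by
      rw [hQ]; simp only [map_one, one_mul, map_neg]; ring
    rw [e]; exact degree_quadratic one_ne_zero
  have hQpos : ∀ a : ℝ, 0 < Q.eval a := by
    intro a
    have h1 : Q.eval a = (a - z.re) ^ 2 + z.im ^ 2 := by
      simp only [hQ, eval_add, eval_sub, eval_pow, eval_X, eval_mul, eval_C,
        Complex.sq_norm, Complex.normSq_apply]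
      ring
    rw [h1]; positivity
  have h0 := orth χ (by rw [hχ, degree_mul, hQd, add_comm])
  have h1 := (Finset.sum_eq_zero_iff_of_nonneg (fun i _ => by
    rw [hχ, eval_mul]
    have := hQpos (l i)
    have e : l i ^ 2 * χ.eval (l i) * (Q.eval (l i) * χ.eval (l i)) * g i ^ 2 =
      l i ^ 2 * Q.eval (l i) * (χ.eval (l i)) ^ 2 * g i ^ 2 := by ring
    rw [e]; positivity)).1 h0 j hj
  have h2 := hQpos (l j)
  have h3 := hl j hj
  rw [hχ, eval_mul] at h1 hne
  simp only [mul_eq_zero, pow_eq_zero_iff, ne_eq, OfNat.ofNat_ne_zero, not_false_eq_true] at h1 hne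
  tauto

lemma eval_eq_coeff_zero_add (p : ℝ[X]) (a : ℝ) : p.eval a = p.coeff 0 + a * p.divX.eval a := by
  conv_lhs => rw [← divX_mul_X_add p]
  simp; ring

lemma degree_divX_lt_of_lt {p : ℝ[X]} {t : ℕ} (h : p.degree < t) : p.divX.degree < t := by
  by_cases hp : p = 0
  · simp [hp]
  · exact (degree_divX_lt hp).trans h

/-- Minimal residuals over `span {g, A g, …}`, in the eigencoordinates of `A`: the iterate with
coordinates `p(λ) g` is no longer than the full solution `g / λ`. -/
lemma sum_sq_le_of_residual_orthogonal (hl : ∀ i ∈ s, l i ≠ 0) {t : ℕ} {p : ℝ[X]}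
    (hp : p.degree < t)
    (orth : ∀ w : ℝ[X], w.degree < t →
      ∑ i ∈ s, (g i - l i * p.eval (l i) * g i) * (l i * w.eval (l i) * g i) = 0) :
    ∑ i ∈ s, (p.eval (l i) * g i) ^ 2 ≤ ∑ i ∈ s, (g i / l i) ^ 2 := by
  set φ : ℝ[X] := 1 - X * p with hφ
  have hφe : ∀ a, φ.eval a = 1 - a * p.eval a := fun a => by simp [hφ]
  have hφd : φ.degree < (t + 1 : ℕ) := by
    rw [degree_lt_iff_coeff_zero] at hp ⊢
    intro k hk
    cases k with
    | zero => omega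
    | succ k => rw [hφ, coeff_sub, coeff_X_mul, hp k (by omega)]; simp [coeff_one]
  rcases im_eq_zero_or_residual_eq_zero (φ := φ) (g := g) hl (fun χ hχ => by
    have hd : (X * χ).degree < (t : WithBot ℕ) := by
      rw [← hχ] at hφd
      by_cases h0 : χ = 0
      · simp [h0]
      · rw [degree_mul, degree_X, degree_eq_natDegree h0]
        rw [degree_eq_natDegree h0] at hφd
        have : χ.natDegree + 2 < t + 1 := by exact_mod_cast hφd
        have : 1 + χ.natDegree < t := by omega
        exact_mod_cast this
    rw [← orth _ hd]
    refine Finset.sum_congr rfl fun i _ => ?_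
    rw [hφe, eval_mul, eval_X]; ring) with hreal | hzero
  · obtain ⟨Z, hZ⟩ := exists_eq_invRootProd _ φ rfl (by simp [hφ]) hreal
    obtain ⟨-, c1, c2, -⟩ := coeff_invRootProd Z
    have hP := powerSum_two_nonneg Z
    have k1 : p.coeff 0 = powerSum 1 Z := by
      rw [← hZ, hφ, coeff_sub, coeff_X_mul] at c1; simp [coeff_one] at c1; linarith
    have k2 : p.coeff 1 = -(powerSum 1 Z ^ 2 - powerSum 2 Z) / 2 := by
      rw [← hZ, hφ, coeff_sub, coeff_X_mul] at c2; simp [coeff_one] at c2; linarith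
    have o1 := orth p hp
    have o2 := orth p.divX (degree_divX_lt_of_lt hp)
    have o3 := orth p.divX.divX (degree_divX_lt_of_lt (degree_divX_lt_of_lt hp))
    set a := p.coeff 0
    set b := p.coeff 1 with hb
    -- `a² + 2 b` is the sum of the squared inverse roots
    have hab : a ^ 2 + 2 * b = powerSum 2 Z := by rw [k1, k2]; ring
    have key : ∑ i ∈ s, ((g i / l i) ^ 2 - (p.eval (l i) * g i) ^ 2) =
        ∑ i ∈ s, (((l i)⁻¹ + a) ^ 2 + powerSum 2 Z) * (g i - l i * p.eval (l i) * g i) ^ 2 := by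
      have e : ∀ i ∈ s, (g i / l i) ^ 2 - (p.eval (l i) * g i) ^ 2 =
          (((l i)⁻¹ + a) ^ 2 + powerSum 2 Z) * (g i - l i * p.eval (l i) * g i) ^ 2 +
          ((2 * a ^ 2 + 2 * b) *
            ((g i - l i * p.eval (l i) * g i) * (l i * p.eval (l i) * g i)) +
          2 * a * ((g i - l i * p.eval (l i) * g i) * (l i * p.divX.eval (l i) * g i)) +
          2 * ((g i - l i * p.eval (l i) * g i) * (l i * p.divX.divX.eval (l i) * g i))) := by
        intro i hi
        have hli := hl i hi
        have e1 : l i * p.divX.eval (l i) = p.eval (l i) - a := by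
          rw [eval_eq_coeff_zero_add p]; ring
        have e2 : l i * p.divX.divX.eval (l i) = (p.eval (l i) - a) / l i - b := by
          rw [← e1, mul_div_cancel_left₀ _ hli, eval_eq_coeff_zero_add p.divX, coeff_divX]
          simp [hb]
        rw [e1, e2, ← hab]
        field_simp
        ring
      rw [Finset.sum_congr rfl e, Finset.sum_add_distrib, Finset.sum_add_distrib,
        Finset.sum_add_distrib, ← Finset.mul_sum, ← Finset.mul_sum, ← Finset.mul_sum, o1, o2, o3]
      ring
    have hnn : 0 ≤ ∑ i ∈ s, ((g i / l i) ^ 2 - (p.eval (l i) * g i) ^ 2) := by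
      rw [key]; exact Finset.sum_nonneg fun i _ => by positivity
    rw [Finset.sum_sub_distrib] at hnn
    linarith
  · refine Finset.sum_le_sum fun i hi => le_of_eq ?_
    have h := hzero i hi
    have hli := hl i hi
    rw [hφe] at h
    congr 1
    field_simp
    linarith

lemma quadratic_form_nonneg {a b c : ℝ} (x y : ℝ) (ha : 0 ≤ a) (hc : 0 ≤ c)
    (h : b ^ 2 ≤ 4 * a * c) : 0 ≤ a * x ^ 2 + b * x * y + c * y ^ 2 := by
  rcases ha.eq_or_lt with rfl | ha
  · have : b = 0 := by
      have : b ^ 2 ≤ 0 := by linarith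
      exact pow_eq_zero_iff (two_ne_zero) |>.1 (le_antisymm this (sq_nonneg b))
    subst this; simp; positivity
  · have : 0 ≤ 4 * a * (a * x ^ 2 + b * x * y + c * y ^ 2) := by
      have e : 4 * a * (a * x ^ 2 + b * x * y + c * y ^ 2) =
        (2 * a * x + b * y) ^ 2 + (4 * a * c - b ^ 2) * y ^ 2 := by ring
      rw [e]
      have : 0 ≤ 4 * a * c - b ^ 2 := by linarith
      positivity
    by_contra hn
    push Not at hn
    nlinarith

/-- The pointwise estimate when the inverse roots are small compared with `1 / m`: here `q` is the
iterate, `r` the residual and `l q + r` the gradient. -/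
lemma pointwise_nonneg_of_small {M m l P c q r : ℝ} (hl : l ≠ 0) (hM : 1 ≤ M ^ 2 * l ^ 2)
    (hP : 0 ≤ P) (hPm : P * m ^ 2 ≤ 2) (hc : c ^ 2 ≤ 16 / 9 * P) :
    0 ≤ ((M ^ 2 * m ^ 2 + 4) / (m ^ 2 + l ^ 2) - 1 / l ^ 2) * (l * q + r) ^ 2 +
      (1 / l ^ 2 + P) * r ^ 2 + c * q * r := by
  obtain ⟨σ, hσ⟩ : ∃ σ, σ = l⁻¹ := ⟨_, rfl⟩
  have hσ0 : σ ≠ 0 := by rw [hσ]; exact inv_ne_zero hl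
  obtain rfl : l = σ⁻¹ := by rw [hσ, inv_inv]
  have hxM : 0 ≤ M ^ 2 - σ ^ 2 := by
    have : M ^ 2 * (σ⁻¹) ^ 2 * σ ^ 2 = M ^ 2 := by field_simp
    nlinarith [sq_nonneg σ, mul_le_mul_of_nonneg_right hM (sq_nonneg σ)]
  set g := σ⁻¹ * q + r with hg
  have hq : q = σ * (g - r) := by rw [hg]; field_simp; ring
  have e : ((M ^ 2 * m ^ 2 + 4) / (m ^ 2 + (σ⁻¹) ^ 2) - 1 / (σ⁻¹) ^ 2) * g ^ 2 +
      (1 / (σ⁻¹) ^ 2 + P) * r ^ 2 + c * q * r =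
      (σ ^ 2 * (m ^ 2 * (M ^ 2 - σ ^ 2) + 3) / (1 + m ^ 2 * σ ^ 2)) * g ^ 2 + (c * σ) * g * r +
      (σ ^ 2 + P - c * σ) * r ^ 2 := by
    have h1 : 1 + m ^ 2 * σ ^ 2 ≠ 0 := by positivity
    have h2 : m ^ 2 + (σ⁻¹) ^ 2 ≠ 0 := by positivity
    rw [hq]
    field_simp
    ring
  rw [e]
  -- `c σ ≤ (2 / 3) (σ² + P)` by the arithmetic-geometric mean inequality
  have hcs : c * σ ≤ 2 / 3 * (σ ^ 2 + P) := by
    refine le_of_abs_le (abs_le_of_sq_le_sq ?_ (by positivity))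
    nlinarith [sq_nonneg (σ ^ 2 - P), mul_le_mul_of_nonneg_right hc (sq_nonneg σ)]
  have hA : 1 / 3 * (σ ^ 2 + P) ≤ σ ^ 2 + P - c * σ := by linarith
  have hk : 0 ≤ σ ^ 2 * (m ^ 2 * (M ^ 2 - σ ^ 2) + 3) / (1 + m ^ 2 * σ ^ 2) := by positivity
  refine quadratic_form_nonneg g r hk (le_trans (by positivity) hA) ?_
  calc (c * σ) ^ 2 ≤ 16 / 9 * P * σ ^ 2 := by
        rw [mul_pow]; gcongr
    _ ≤ 4 * (σ ^ 2 * (m ^ 2 * (M ^ 2 - σ ^ 2) + 3) / (1 + m ^ 2 * σ ^ 2)) *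
        (1 / 3 * (σ ^ 2 + P)) := by
      have h0 : 0 < 1 + m ^ 2 * σ ^ 2 := by positivity
      have h1 : 4 / 3 * P * (1 + m ^ 2 * σ ^ 2) ≤
          (m ^ 2 * (M ^ 2 - σ ^ 2) + 3) * (σ ^ 2 + P) := by
        have : 0 ≤ (m ^ 2 * (M ^ 2 - σ ^ 2)) * (σ ^ 2 + P) := by positivity
        nlinarith [mul_le_mul_of_nonneg_right hPm (sq_nonneg σ), sq_nonneg σ]
      rw [show 4 * (σ ^ 2 * (m ^ 2 * (M ^ 2 - σ ^ 2) + 3) / (1 + m ^ 2 * σ ^ 2)) *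
        (1 / 3 * (σ ^ 2 + P)) = 4 / 3 * σ ^ 2 * ((m ^ 2 * (M ^ 2 - σ ^ 2) + 3) * (σ ^ 2 + P)) /
          (1 + m ^ 2 * σ ^ 2) by ring, le_div_iff₀ h0]
      nlinarith [mul_le_mul_of_nonneg_right h1 (sq_nonneg σ)]
    _ ≤ _ := by gcongr

/-- The pointwise estimate when the inverse roots are large compared with `1 / m`. -/
lemma pointwise_nonneg_of_large {M m l k τ q r : ℝ} (hm : 0 < m) (hl : l ≠ 0)
    (hM : 1 ≤ M ^ 2 * l ^ 2) (hk : 2 * τ ^ 2 ≤ 3 * k) (hτ : τ ^ 2 ≤ 3) :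
    0 ≤ (M ^ 2 * m ^ 2 + 4) / m ^ 2 * ((m ^ 2 + 2 * k * l ^ 2) * r ^ 2 -
        2 * τ * m * l * (l * q) * r + m ^ 2 * (l * q) ^ 2) / (m ^ 2 + l ^ 2) - q ^ 2 := by
  have hk0 : 0 ≤ k := by nlinarith [sq_nonneg τ]
  set y := M ^ 2 * l ^ 2 - 1 with hy
  have hy0 : 0 ≤ y := by linarith
  set K := M ^ 2 * m ^ 2 + 4 with hK
  have hK0 : 0 < K := by positivity
  have e : K / m ^ 2 * ((m ^ 2 + 2 * k * l ^ 2) * r ^ 2 -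
        2 * τ * m * l * (l * q) * r + m ^ 2 * (l * q) ^ 2) / (m ^ 2 + l ^ 2) - q ^ 2 =
      (K / m ^ 2 * (m ^ 2 + 2 * k * l ^ 2) * r ^ 2 + (-(2 * τ * l ^ 2 * K / m)) * r * q +
        (m ^ 2 * y + 3 * l ^ 2) * q ^ 2) / (m ^ 2 + l ^ 2) := by
    have : m ^ 2 + l ^ 2 ≠ 0 := by positivity
    rw [hy, hK]
    field_simp
    ring
  rw [e]
  refine div_nonneg (quadratic_form_nonneg r q (by positivity) (by positivity) ?_) (by positivity)
  have e2 : (-(2 * τ * l ^ 2 * K / m)) ^ 2 = 4 * K / m ^ 2 * (τ ^ 2 * (K * l ^ 4)) := by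
    field_simp
    ring
  have e3 : 4 * (K / m ^ 2 * (m ^ 2 + 2 * k * l ^ 2)) * (m ^ 2 * y + 3 * l ^ 2) =
    4 * K / m ^ 2 * ((m ^ 2 + 2 * k * l ^ 2) * (m ^ 2 * y + 3 * l ^ 2)) := by ring
  rw [e2, e3]
  refine mul_le_mul_of_nonneg_left ?_ (by positivity)
  have e4 : K * l ^ 4 = m ^ 2 * l ^ 2 * (y + 1) + 4 * l ^ 4 := by rw [hK, hy]; ring
  rw [e4]
  have h1 : 0 ≤ m ^ 4 * y := by positivity
  have h2 : 0 ≤ (3 - τ ^ 2) * (m ^ 2 * l ^ 2) := mul_nonneg (by linarith) (by positivity)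
  have h3 : 0 ≤ (3 * k - 2 * τ ^ 2) * (m ^ 2 * l ^ 2 * y) :=
    mul_nonneg (by linarith) (by positivity)
  have h4 : 0 ≤ (3 * k - 2 * τ ^ 2) * l ^ 4 := mul_nonneg (by linarith) (by positivity)
  have h5 : 0 ≤ τ ^ 2 * (m ^ 2 * l ^ 2 * y) := by positivity
  nlinarith

lemma sum_nonneg_of_le_of_sum_eq_zero {e f : ι → ℝ} (he : ∑ i ∈ s, e i = 0)
    (h : ∀ i ∈ s, e i ≤ f i) : 0 ≤ ∑ i ∈ s, f i := he ▸ Finset.sum_le_sum h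

/-- With small inverse roots, `∑ (g² / λ² - q²)` is `∑ (1 / λ² + P) r²` plus a cross term
`c ∑ q r`, where `q` is the iterate, `r` the residual, and `P`, `P₃` are the power sums of the
inverse roots; it is nearly a difference of norms. -/
lemma sum_sq_le_of_inverse_roots_small (hl : ∀ i ∈ s, l i ≠ 0) {M m : ℝ}
    (hM : ∀ i ∈ s, 1 ≤ M ^ 2 * l i ^ 2) {t : ℕ} {p : ℝ[X]} (hp : p.degree < t)
    (orth : ∀ w : ℝ[X], w.degree < t →
      ∑ i ∈ s, (g i - l i ^ 2 * p.eval (l i) * g i) * (l i ^ 2 * w.eval (l i) * g i) = 0)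
    {P P₃ : ℝ} (hP : 0 ≤ P) (hP3 : P₃ ^ 2 ≤ P ^ 3) (h0 : 2 * p.coeff 0 = P)
    (h1 : 2 * p.coeff 1 = 2 / 3 * P₃) (hPm : P * m ^ 2 ≤ 2) :
    ∑ i ∈ s, (p.eval (l i) * l i * g i) ^ 2 ≤
      ∑ i ∈ s, (M ^ 2 * m ^ 2 + 4) / (m ^ 2 + l i ^ 2) * g i ^ 2 := by
  obtain ⟨c, hcP, hc⟩ : ∃ c, c * P = 4 / 3 * P₃ ∧ c ^ 2 ≤ 16 / 9 * P := by
    rcases hP.eq_or_lt with h0 | hpos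
    · refine ⟨0, ?_, by rw [← h0]; norm_num⟩
      rw [← h0] at hP3
      have : P₃ = 0 := by nlinarith [sq_nonneg P₃]
      simp [this]
    · refine ⟨4 / 3 * P₃ / P, by field_simp, ?_⟩
      rw [div_pow, div_le_iff₀ (by positivity)]
      nlinarith
  have o0 := orth p hp
  have o1 := orth p.divX (degree_divX_lt_of_lt hp)
  have o2 := orth p.divX.divX (degree_divX_lt_of_lt (degree_divX_lt_of_lt hp))
  rw [← sub_nonneg, ← Finset.sum_sub_distrib]
  refine sum_nonneg_of_le_of_sum_eq_zero (e := fun i =>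
      P * ((g i - l i ^ 2 * p.eval (l i) * g i) * (l i ^ 2 * p.eval (l i) * g i)) +
      (-c) * ((g i - l i ^ 2 * p.eval (l i) * g i) * (l i ^ 2 * p.divX.eval (l i) * g i)) +
      2 * ((g i - l i ^ 2 * p.eval (l i) * g i) * (l i ^ 2 * p.divX.divX.eval (l i) * g i)))
    ?_ fun i hi => ?_
  · rw [Finset.sum_add_distrib, Finset.sum_add_distrib, ← Finset.mul_sum, ← Finset.mul_sum,
      ← Finset.mul_sum, o0, o1, o2]
    ring
  · have hli := hl i hi
    have e1 : l i ^ 2 * p.divX.eval (l i) = l i * (p.eval (l i) - P / 2) := by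
      rw [eval_eq_coeff_zero_add p, ← h0]; ring
    have e2 : l i ^ 2 * p.divX.divX.eval (l i) =
        p.eval (l i) - P / 2 - c * P / 4 * l i := by
      have h : p.eval (l i) = p.coeff 0 + l i * (p.coeff 1 + l i * p.divX.divX.eval (l i)) := by
        rw [eval_eq_coeff_zero_add p, eval_eq_coeff_zero_add p.divX, coeff_divX]
      rw [h, hcP, ← h0]; linear_combination (-l i / 2) * h1
    have hpt := pointwise_nonneg_of_small (q := p.eval (l i) * l i * g i)
      (r := g i - l i ^ 2 * p.eval (l i) * g i) hli (hM i hi) hP hPm hc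
    rw [show l i * (p.eval (l i) * l i * g i) + (g i - l i ^ 2 * p.eval (l i) * g i) = g i by
      ring] at hpt
    rw [e1, e2, ← sub_nonneg]
    refine hpt.trans_eq ?_
    field_simp
    ring

/-- Comparison of the residual polynomial at `l` with its value `a + m b i` at the imaginary point
`m i`, where `F = 1 - φ(l)`, `x` is the quotient of `φ(l) - a - b l` by `l² + m²` and `W` the
value of the test polynomial. -/
lemma residual_identity {K m l a b x x₀ F W g D Q : ℝ} (hD : D = m ^ 2 + l ^ 2) (hD0 : D ≠ 0)
    (hQ : Q = a ^ 2 + m ^ 2 * b ^ 2 - a) (hQ0 : Q ≠ 0) (hF : F = 1 - (a + b * l + D * x))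
    (hx : m ^ 2 * x₀ = 1 - a)
    (hW : W = l ^ 2 * (1 - a) * x - m ^ 2 * b * l * (x - x₀)) :
    K * m ^ 2 / D * g ^ 2 =
      K * ((m ^ 2 + 2 * (((a - 1) ^ 2 + m ^ 2 * b ^ 2) / Q) * l ^ 2) * ((1 - F) * g) ^ 2 -
        2 * (-(m * b) / Q) * m * l * (F * g) * ((1 - F) * g) + m ^ 2 * (F * g) ^ 2) / D +
      (2 * K * ((1 - F) * g * (F * g)) - 2 * K / Q * ((1 - F) * g * (W * g))) := by
  have core : D * W = ((a - 1) ^ 2 + m ^ 2 * b ^ 2) * l ^ 2 * (1 - F) + m ^ 2 * b * l * F +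
      Q * l ^ 2 * F := by
    rw [hW, hF, hQ, hD]
    linear_combination (m ^ 2 + l ^ 2) * b * l * hx
  have h1 : D * D⁻¹ = 1 := mul_inv_cancel₀ hD0
  have h2 : Q * Q⁻¹ = 1 := mul_inv_cancel₀ hQ0
  simp only [div_eq_mul_inv]
  have h3 : m ^ 2 = D - l ^ 2 := by rw [hD]; ring
  linear_combination 2 * K * ((1 - F) * g) * g * ((F - Q⁻¹ * W) * h1 + D⁻¹ * Q⁻¹ * core +
    D⁻¹ * l ^ 2 * F * h2 + F * D⁻¹ * h3)

/-- With large inverse roots, the residual polynomial is large at the imaginary point `m i`;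
dividing it by `X² + m²` gives the test polynomial that compares iterate and residual under the
weight `1 / (m² + λ²)`. -/
lemma sum_sq_le_of_inverse_roots_large (hl : ∀ i ∈ s, l i ≠ 0) {M m : ℝ}
    (hM : ∀ i ∈ s, 1 ≤ M ^ 2 * l i ^ 2) (hm : 0 < m) {t : ℕ} {p : ℝ[X]} (hp : p.degree < t)
    (orth : ∀ w : ℝ[X], w.degree < t →
      ∑ i ∈ s, (g i - l i ^ 2 * p.eval (l i) * g i) * (l i ^ 2 * w.eval (l i) * g i) = 0)
    {a b : ℝ} {χ : ℝ[X]} (hχd : χ.degree < t)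
    (hχ : 1 - X ^ 2 * p = C a + C b * X + (X ^ 2 + C (m ^ 2)) * χ)
    (hN : 3 ≤ a ^ 2 + m ^ 2 * b ^ 2) :
    ∑ i ∈ s, (p.eval (l i) * l i * g i) ^ 2 ≤
      ∑ i ∈ s, (M ^ 2 * m ^ 2 + 4) / (m ^ 2 + l i ^ 2) * g i ^ 2 := by
  have hev : ∀ z, 1 - z ^ 2 * p.eval z = a + b * z + (z ^ 2 + m ^ 2) * χ.eval z := fun z => by
    have := congrArg (fun q => q.eval z) hχ
    simpa only [eval_add, eval_sub, eval_one, eval_mul, eval_C, eval_X, eval_pow] using this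
  have hχ0 : m ^ 2 * χ.coeff 0 = 1 - a := by
    have := hev 0
    rw [← coeff_zero_eq_eval_zero χ] at this
    linarith
  -- this test polynomial eliminates the first moment `∑ λ g r` of the residual
  set w : ℝ[X] := C (1 - a) * χ - C (m ^ 2 * b) * χ.divX with hw
  have hwd : w.degree < (t : WithBot ℕ) := by
    have h2 := degree_divX_lt_of_lt hχd
    refine lt_of_le_of_lt (degree_sub_le _ _) (max_lt ?_ ?_)
    · exact lt_of_le_of_lt (by rw [← smul_eq_C_mul]; exact degree_smul_le _ _) hχd
    · exact lt_of_le_of_lt (by rw [← smul_eq_C_mul]; exact degree_smul_le _ _) h2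
  have o0 := orth p hp
  have o1 := orth w hwd
  set Q := a ^ 2 + m ^ 2 * b ^ 2 - a with hQ
  have hQ1 : 5 / 4 ≤ Q := by nlinarith [sq_nonneg (a - 3 / 2), sq_nonneg (m * b)]
  have hQpos : 0 < Q := by linarith
  set k := ((a - 1) ^ 2 + m ^ 2 * b ^ 2) / Q with hk
  set τ := -(m * b) / Q with hτ
  have hτ2 : τ ^ 2 * Q ^ 2 = m ^ 2 * b ^ 2 := by rw [hτ]; field_simp
  have hkQ : k * Q = (a - 1) ^ 2 + m ^ 2 * b ^ 2 := by rw [hk]; field_simp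
  have hτk : 2 * τ ^ 2 ≤ 3 * k := by
    have : 2 * τ ^ 2 * Q ^ 2 ≤ 3 * k * Q ^ 2 := by
      have e1 : 3 * k * Q ^ 2 = 3 * Q * ((a - 1) ^ 2 + m ^ 2 * b ^ 2) := by
        rw [← hkQ]; ring
      rw [e1]
      nlinarith [mul_nonneg (by linarith : 0 ≤ Q - 5 / 4)
        (by positivity : 0 ≤ (a - 1) ^ 2 + m ^ 2 * b ^ 2), sq_nonneg (a - 1), sq_nonneg (m * b)]
    exact le_of_mul_le_mul_right this (by positivity)
  have hτ3 : τ ^ 2 ≤ 3 := by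
    have : τ ^ 2 * Q ^ 2 ≤ 3 * Q ^ 2 := by
      rw [hτ2]
      nlinarith [mul_nonneg (by linarith : 0 ≤ Q - 5 / 4) hQpos.le, sq_nonneg (a - 15 / 8)]
    exact le_of_mul_le_mul_right this (by positivity)
  obtain ⟨K, hK⟩ : ∃ K, K = (M ^ 2 * m ^ 2 + 4) / m ^ 2 := ⟨_, rfl⟩
  have hKm : M ^ 2 * m ^ 2 + 4 = K * m ^ 2 := by rw [hK]; field_simp
  rw [← sub_nonneg, ← Finset.sum_sub_distrib]
  refine sum_nonneg_of_le_of_sum_eq_zero (e := fun i =>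
      2 * K * ((g i - l i ^ 2 * p.eval (l i) * g i) * (l i ^ 2 * p.eval (l i) * g i)) -
      2 * K / Q * ((g i - l i ^ 2 * p.eval (l i) * g i) * (l i ^ 2 * w.eval (l i) * g i)))
    ?_ fun i hi => ?_
  · rw [Finset.sum_sub_distrib, ← Finset.mul_sum, ← Finset.mul_sum, o0, o1]
    ring
  · have hD : m ^ 2 + l i ^ 2 ≠ 0 := by positivity
    have hwe : l i ^ 2 * w.eval (l i) = l i ^ 2 * (1 - a) * χ.eval (l i) -
        m ^ 2 * b * l i * (χ.eval (l i) - χ.coeff 0) := by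
      have h := eval_eq_coeff_zero_add χ (l i)
      have h2 : w.eval (l i) = (1 - a) * χ.eval (l i) - m ^ 2 * b * χ.divX.eval (l i) := by
        simp only [hw, eval_sub, eval_mul, eval_C]
      rw [h2]
      linear_combination (m ^ 2 * b * l i) * h
    have hid := residual_identity (K := K) (g := g i) rfl hD hQ hQpos.ne'
      (show l i ^ 2 * p.eval (l i) = 1 - (a + b * l i + (m ^ 2 + l i ^ 2) * χ.eval (l i)) by
        linear_combination -hev (l i)) hχ0 hwe
    have hpt := pointwise_nonneg_of_large (q := p.eval (l i) * l i * g i)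
      (r := g i - l i ^ 2 * p.eval (l i) * g i) hm (hl i hi) (hM i hi) hτk hτ3
    rw [← hK] at hpt
    rw [← hk, ← hτ] at hid
    rw [show (1 - l i ^ 2 * p.eval (l i)) * g i = g i - l i ^ 2 * p.eval (l i) * g i by ring] at hid
    rw [show l i * (p.eval (l i) * l i * g i) = l i ^ 2 * p.eval (l i) * g i by ring] at hpt
    rw [hKm, hid]
    linarith

/-- Minimal residuals over `span {A g, A² g, …}`, in the eigencoordinates of `A`: the iterate has
coordinates `p(λ) λ g` and the residual polynomial is `1 - X² p`. -/
lemma sum_sq_le_of_shifted_residual_orthogonal (hl : ∀ i ∈ s, l i ≠ 0) {M m : ℝ}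
    (hM : ∀ i ∈ s, 1 ≤ M ^ 2 * l i ^ 2) (hm : 0 < m) {t : ℕ} {p : ℝ[X]} (hp : p.degree < t)
    (orth : ∀ w : ℝ[X], w.degree < t →
      ∑ i ∈ s, (g i - l i ^ 2 * p.eval (l i) * g i) * (l i ^ 2 * w.eval (l i) * g i) = 0) :
    ∑ i ∈ s, (p.eval (l i) * l i * g i) ^ 2 ≤
      ∑ i ∈ s, (M ^ 2 * m ^ 2 + 4) / (m ^ 2 + l i ^ 2) * g i ^ 2 := by
  set φ : ℝ[X] := 1 - X ^ 2 * p with hφ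
  have hφe : ∀ a, φ.eval a = 1 - a ^ 2 * p.eval a := fun a => by simp [hφ]
  have hφc : ∀ k, φ.coeff (k + 2) = -p.coeff k := fun k => by
    rw [hφ, coeff_sub, coeff_X_pow_mul]; simp [coeff_one]
  have hφ0 : φ.coeff 0 = 1 := by simp [hφ]
  have hφ1 : φ.coeff 1 = 0 := by
    rw [hφ, pow_two, mul_assoc, coeff_sub, coeff_X_mul]; simp [coeff_one]
  have hφd : φ.degree < (t + 2 : ℕ) := by
    rw [degree_lt_iff_coeff_zero] at hp ⊢
    intro k hk
    obtain ⟨k, rfl⟩ : ∃ j, k = j + 2 := ⟨k - 2, by omega⟩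
    rw [hφc, hp k (by omega), neg_zero]
  rcases im_eq_zero_or_residual_eq_zero (φ := φ) (g := g) hl (fun χ hχ => by
    have hd : χ.degree < (t : WithBot ℕ) := by
      rw [← hχ] at hφd
      by_cases h0 : χ = 0
      · simp [h0]
      · rw [degree_eq_natDegree h0] at hφd ⊢
        have : χ.natDegree + 2 < t + 2 := by exact_mod_cast hφd
        have : χ.natDegree < t := by omega
        exact_mod_cast this
    rw [← orth _ hd]
    refine Finset.sum_congr rfl fun i _ => ?_
    rw [hφe]; ring) with hreal | hzero
  · obtain ⟨Z, hZ⟩ := exists_eq_invRootProd _ φ rfl hφ0 hreal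
    obtain ⟨-, c1, c2, c3⟩ := coeff_invRootProd Z
    rw [← hZ] at c1 c2 c3
    have hP := powerSum_two_nonneg Z
    have h1 : powerSum 1 Z = 0 := by linarith
    have k0 : 2 * p.coeff 0 = powerSum 2 Z := by
      rw [hφc 0, h1] at c2; linarith
    have k1 : 2 * p.coeff 1 = 2 / 3 * powerSum 3 Z := by
      rw [hφc 1, h1] at c3; linarith
    set P := powerSum 2 Z with hPdef
    rcases le_total (P * m ^ 2) 2 with hsmall | hlarge
    · have h3 := abs_powerSum_three_le Z (Real.sqrt P) (Real.sqrt_nonneg _)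
        (by rw [Real.sq_sqrt hP])
      have h3' : powerSum 3 Z ^ 2 ≤ P ^ 3 := by
        rw [← sq_abs]
        calc |powerSum 3 Z| ^ 2 ≤ (Real.sqrt P * P) ^ 2 := by gcongr
          _ = P ^ 3 := by rw [mul_pow, Real.sq_sqrt hP]; ring
      exact sum_sq_le_of_inverse_roots_small hl hM hp orth hP h3' k0 k1 hsmall
    · obtain ⟨a, b, χ, hχ, hχd, hnorm⟩ := exists_eq_add_sq_add_mul φ m
      refine sum_sq_le_of_inverse_roots_large hl hM hm hp orth (hχd t hφd) hχ ?_
      have := le_normSq_aeval_invRootProd Z m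
      rw [← hZ, hnorm] at this
      linarith [mul_comm P (m ^ 2)]
  · refine Finset.sum_le_sum fun i hi => ?_
    have h := hzero i hi
    have hli := hl i hi
    rw [hφe] at h
    have h1 : p.eval (l i) * l i * g i = g i / l i := by field_simp; linarith
    rw [h1, div_pow, div_eq_mul_inv, mul_comm]
    refine mul_le_mul_of_nonneg_right ?_ (sq_nonneg _)
    rw [inv_eq_one_div, div_le_div_iff₀ (by positivity) (by positivity)]
    nlinarith [mul_le_mul_of_nonneg_right (hM i hi) (sq_nonneg m), sq_nonneg (l i)]

end Residual

/-! ### Symmetric operators in eigencoordinates -/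

section Eigen

variable {d : ℕ} {A : Op d}

/-- An orthonormal basis of eigenvectors of a symmetric operator. -/
noncomputable def eigenBasis (hA : A.toLinearMap.IsSymmetric) :
    OrthonormalBasis (Fin d) ℝ (Vec d) :=
  hA.eigenvectorBasis finrank_euclideanSpace_fin

/-- The eigenvalue of the `i`-th vector of `eigenBasis`. -/
noncomputable def eigenVal (hA : A.toLinearMap.IsSymmetric) (i : Fin d) : ℝ :=
  hA.eigenvalues finrank_euclideanSpace_fin i

/-- The `i`-th coordinate of `v` in `eigenBasis`. -/
noncomputable def eigenCoord (hA : A.toLinearMap.IsSymmetric) (i : Fin d) : Vec d →ₗ[ℝ] ℝ where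
  toFun v := (eigenBasis hA).repr v i
  map_add' := by simp
  map_smul' := by simp

variable (hA : A.toLinearMap.IsSymmetric)

lemma eigenCoord_apply (v : Vec d) (i : Fin d) :
    eigenCoord hA i (A v) = eigenVal hA i * eigenCoord hA i v :=
  hA.eigenvectorBasis_apply_self_apply finrank_euclideanSpace_fin v i

lemma eigenCoord_pow_apply (n : ℕ) (v : Vec d) (i : Fin d) :
    eigenCoord hA i ((A ^ n) v) = eigenVal hA i ^ n * eigenCoord hA i v := by
  induction n with
  | zero => simp
  | succ n ih =>
    rw [pow_succ', mul_apply_eq_comp, eigenCoord_apply, ih]; ring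

lemma apply_eigenBasis (i : Fin d) : A (eigenBasis hA i) = eigenVal hA i • eigenBasis hA i :=
  hA.apply_eigenvectorBasis finrank_euclideanSpace_fin i

lemma norm_sq_eq_sum_eigenCoord (v : Vec d) : ‖v‖ ^ 2 = ∑ i, eigenCoord hA i v ^ 2 := by
  rw [← (eigenBasis hA).repr.norm_map, EuclideanSpace.norm_sq_eq]
  simp [eigenCoord]

lemma inner_eq_sum_eigenCoord (v w : Vec d) :
    inner ℝ v w = ∑ i, eigenCoord hA i v * eigenCoord hA i w := by
  rw [← (eigenBasis hA).repr.inner_map_map, PiLp.inner_apply]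
  simp [eigenCoord, mul_comm]

lemma one_le_sq_mul_eigenVal_sq {M : ℝ} (hM : ‖pinv A‖ ≤ M) {i : Fin d}
    (hi : eigenVal hA i ≠ 0) : 1 ≤ M ^ 2 * eigenVal hA i ^ 2 := by
  have h1 : eigenBasis hA i ∈ (nullOf A)ᗮ := by
    refine (Submodule.mem_orthogonal _ _).2 fun n hn => ?_
    have hn' : A n = 0 := hn
    have h := hA n (eigenBasis hA i)
    simp only [ContinuousLinearMap.coe_coe] at h
    rw [hn', apply_eigenBasis, inner_zero_left, inner_smul_right] at h
    exact (mul_eq_zero.1 h.symm).resolve_left hi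
  have h2 := pinv_apply A (eigenBasis hA i)
  rw [Submodule.starProjection_eq_self_iff.2 h1, apply_eigenBasis] at h2
  have h3 := (pinv A).le_of_opNorm_le hM (eigenVal hA i • eigenBasis hA i)
  rw [h2, norm_smul, (eigenBasis hA).norm_eq_one, mul_one, Real.norm_eq_abs] at h3
  calc (1 : ℝ) = 1 ^ 2 := by norm_num
    _ ≤ (M * |eigenVal hA i|) ^ 2 := by gcongr
    _ = _ := by rw [mul_pow, sq_abs]

lemma exists_polynomial_of_mem_krylov {b v : Vec d} {t : ℕ} (hv : v ∈ krylov A b t) :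
    ∃ p : ℝ[X], p.degree < t ∧
      ∀ i, eigenCoord hA i v = p.eval (eigenVal hA i) * eigenCoord hA i b := by
  induction hv using Submodule.span_induction with
  | mem v hv =>
    obtain ⟨n, hn, rfl⟩ := hv
    refine ⟨X ^ n, ?_, fun i => by rw [eigenCoord_pow_apply]; simp⟩
    rw [degree_X_pow]; exact_mod_cast hn
  | zero => exact ⟨0, by simp, by simp⟩
  | add v w _ _ hv hw =>
    obtain ⟨p, hp, hp'⟩ := hv
    obtain ⟨q, hq, hq'⟩ := hw
    exact ⟨p + q, lt_of_le_of_lt (degree_add_le _ _) (max_lt hp hq),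
      fun i => by rw [map_add, hp', hq', eval_add]; ring⟩
  | smul a v _ hv =>
    obtain ⟨p, hp, hp'⟩ := hv
    exact ⟨a • p, lt_of_le_of_lt (degree_smul_le _ _) hp,
      fun i => by rw [map_smul, hp', eval_smul, smul_eq_mul, smul_eq_mul]; ring⟩

lemma exists_mem_krylov_of_polynomial (b : Vec d) {t : ℕ} {p : ℝ[X]} (hp : p.degree < t) :
    ∃ v ∈ krylov A b t,
      ∀ i, eigenCoord hA i v = p.eval (eigenVal hA i) * eigenCoord hA i b := by
  refine ⟨∑ n ∈ Finset.range t, p.coeff n • (A ^ n) b, ?_, fun i => ?_⟩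
  · exact Submodule.sum_mem _ fun n hn => Submodule.smul_mem _ _
      (Submodule.subset_span ⟨n, Finset.mem_range.1 hn, rfl⟩)
  · have hp' : p ∈ degreeLT ℝ t := mem_degreeLT.2 hp
    rw [map_sum, Finset.sum_congr rfl (fun n _ => by
      rw [map_smul, eigenCoord_pow_apply, smul_eq_mul, ← mul_assoc])]
    rw [← Finset.sum_mul]
    congr 1
    by_cases h0 : p = 0
    · simp [h0]
    · refine (eval_eq_sum_range' ?_ _).symm
      exact (natDegree_lt_iff_degree_lt h0).2 hp

/-- The coordinates along the null space drop out of the norm of a vector that has none. -/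
lemma norm_sq_eq_sum_filter {v : Vec d} (hv : ∀ i, eigenVal hA i = 0 → eigenCoord hA i v = 0) :
    ‖v‖ ^ 2 = ∑ i with eigenVal hA i ≠ 0, eigenCoord hA i v ^ 2 := by
  rw [norm_sq_eq_sum_eigenCoord hA, Finset.sum_filter_of_ne]
  intro i _ h h0
  exact h (by simp [hv i h0])

lemma sum_filter_eigenCoord_le (v : Vec d) :
    ∑ i with eigenVal hA i ≠ 0, eigenCoord hA i v ^ 2 ≤ ‖v‖ ^ 2 := by
  rw [norm_sq_eq_sum_eigenCoord hA]
  exact Finset.sum_le_sum_of_subset_of_nonneg (Finset.filter_subset _ _)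
    fun i _ _ => sq_nonneg _

end Eigen

/-! ### Minimal residual iterates over range-invariant Krylov subspaces -/

lemma inner_residual_eq_zero {d : ℕ} {A : Op d} {g p : Vec d} {K : Submodule ℝ (Vec d)}
    (hp : p ∈ lsArgmin A g K) {k : Vec d} (hk : k ∈ K) : inner ℝ (A p + g) (A k) = 0 := by
  have h : ∀ a : ℝ, 0 ≤ ‖A k‖ ^ 2 * (a * a) + (2 * inner ℝ (A p + g) (A k)) * a + 0 := by
    intro a
    have h1 := hp.2 (p + a • k) (K.add_mem hp.1 (K.smul_mem _ hk))
    rw [map_add, map_smul, add_right_comm, norm_add_sq_real (A p + g), inner_smul_right, norm_smul,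
      mul_pow, Real.norm_eq_abs, sq_abs] at h1
    linarith
  have := discrim_le_zero h
  unfold discrim at this
  have h2 : (2 * inner ℝ (A p + g) (A k)) ^ 2 ≤ 0 := by linarith
  have h3 := pow_eq_zero_iff (two_ne_zero) |>.1 (le_antisymm h2 (sq_nonneg _))
  linarith

section Iterate

variable {d : ℕ} {A : Op d}

lemma eigenCoord_eq_zero_of_mem_krylov (hA : A.toLinearMap.IsSymmetric) {g p : Vec d} {t : ℕ}
    {K : Submodule ℝ (Vec d)} (hK : IsRangeInvariantKrylov A g t K) (hp : p ∈ K) {i : Fin d}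
    (hi : eigenVal hA i = 0) : eigenCoord hA i p = 0 := by
  rcases hK with ⟨⟨z, rfl⟩, rfl⟩ | rfl
  · obtain ⟨q, -, hq⟩ := exists_polynomial_of_mem_krylov hA hp
    rw [hq, ContinuousLinearMap.coe_coe, eigenCoord_apply, hi]; ring
  · obtain ⟨q, -, hq⟩ := exists_polynomial_of_mem_krylov hA hp
    rw [hq, eigenCoord_apply, hi]; ring

lemma one_div_sq_le {M l : ℝ} (m : ℝ) (hl : l ≠ 0) (hM : 1 ≤ M ^ 2 * l ^ 2) :
    1 / l ^ 2 ≤ (M ^ 2 * m ^ 2 + 4) / (m ^ 2 + l ^ 2) := by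
  rw [div_le_div_iff₀ (by positivity) (by positivity)]
  nlinarith [mul_le_mul_of_nonneg_right hM (sq_nonneg m), sq_nonneg l]

/-- The scalar estimates, in the two kinds of Krylov subspace, give one bound for the iterate. -/
lemma norm_sq_le_sum_of_mem_lsArgmin (hA : A.toLinearMap.IsSymmetric) {M m : ℝ}
    (hM : ‖pinv A‖ ≤ M) (hm : 0 < m) {g p : Vec d} {t : ℕ} {K : Submodule ℝ (Vec d)}
    (hK : IsRangeInvariantKrylov A g t K) (hp : p ∈ lsArgmin A g K) :
    ‖p‖ ^ 2 ≤ ∑ i with eigenVal hA i ≠ 0,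
      (M ^ 2 * m ^ 2 + 4) / (m ^ 2 + eigenVal hA i ^ 2) * eigenCoord hA i g ^ 2 := by
  have hl : ∀ i ∈ (Finset.univ.filter fun i => eigenVal hA i ≠ 0), eigenVal hA i ≠ 0 := by simp
  have hMl : ∀ i ∈ (Finset.univ.filter fun i => eigenVal hA i ≠ 0),
      1 ≤ M ^ 2 * eigenVal hA i ^ 2 :=
    fun i hi => one_le_sq_mul_eigenVal_sq hA hM (hl i hi)
  rw [norm_sq_eq_sum_filter hA fun i hi => eigenCoord_eq_zero_of_mem_krylov hA hK hp.1 hi]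
  rcases hK with ⟨-, rfl⟩ | rfl
  · obtain ⟨q, hq, hqc⟩ := exists_polynomial_of_mem_krylov hA hp.1
    have h := sum_sq_le_of_residual_orthogonal (g := fun i => eigenCoord hA i g) hl
      (p := -q) (by rwa [degree_neg]) (fun w hw => by
        obtain ⟨k, hk, hkc⟩ := exists_mem_krylov_of_polynomial hA g hw
        have ho := inner_residual_eq_zero hp hk
        rw [inner_eq_sum_eigenCoord hA] at ho
        rw [Finset.sum_filter]
        refine (Finset.sum_congr rfl fun i _ => ?_).trans ho
        rw [map_add, eigenCoord_apply, eigenCoord_apply, hqc, hkc, eval_neg]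
        split_ifs with h
        · ring
        · simp [not_not.1 h])
    calc _ = ∑ i with eigenVal hA i ≠ 0,
          ((-q).eval (eigenVal hA i) * eigenCoord hA i g) ^ 2 :=
        Finset.sum_congr rfl fun i _ => by rw [hqc, eval_neg]; ring
      _ ≤ _ := h
      _ ≤ _ := Finset.sum_le_sum fun i hi => by
        rw [div_pow, div_eq_mul_one_div, mul_comm]
        exact mul_le_mul_of_nonneg_right (one_div_sq_le m (hl i hi) (hMl i hi)) (sq_nonneg _)
  · obtain ⟨q, hq, hqc⟩ := exists_polynomial_of_mem_krylov hA hp.1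
    refine le_trans (le_of_eq ?_) (sum_sq_le_of_shifted_residual_orthogonal
      (g := fun i => eigenCoord hA i g) hl hMl hm (p := -q) (by rwa [degree_neg]) (fun w hw => ?_))
    · exact Finset.sum_congr rfl fun i _ => by rw [hqc, eval_neg, eigenCoord_apply]; ring
    · obtain ⟨k, hk, hkc⟩ := exists_mem_krylov_of_polynomial hA (A g) hw
      have ho := inner_residual_eq_zero hp hk
      rw [inner_eq_sum_eigenCoord hA] at ho
      rw [Finset.sum_filter]
      refine (Finset.sum_congr rfl fun i _ => ?_).trans ho
      rw [map_add, eigenCoord_apply, eigenCoord_apply, hqc, hkc, eval_neg, eigenCoord_apply]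
      split_ifs with h
      · ring
      · simp [not_not.1 h]

lemma le_of_forall_weighted_sq_le {M α ω n : ℝ} (hM : 0 < M) (hα : 0 ≤ α) (hω : 0 ≤ ω)
    (h : ∀ m > 0, n ^ 2 ≤ (M ^ 2 * m ^ 2 + 4) * (α ^ 2 / m ^ 2 + ω ^ 2)) :
    n ≤ M * α + 2 * ω := by
  refine le_of_forall_pos_le_add fun δ hδ => ?_
  set η := δ / (M + 2) with hη
  have hη0 : 0 < η := by positivity
  have hαη : 0 < α + η := by linarith
  have hωη : 0 < ω + η := by linarith
  -- the weight that minimises the right-hand side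
  set m := Real.sqrt (2 * (α + η) / (M * (ω + η))) with hm
  have hm0 : 0 < m := Real.sqrt_pos.2 (by positivity)
  have hm2 : m ^ 2 = 2 * (α + η) / (M * (ω + η)) := Real.sq_sqrt (by positivity)
  have h1 : n ^ 2 ≤ (M * (α + η) + 2 * (ω + η)) ^ 2 := by
    calc n ^ 2 ≤ (M ^ 2 * m ^ 2 + 4) * (α ^ 2 / m ^ 2 + ω ^ 2) := h m hm0
      _ ≤ (M ^ 2 * m ^ 2 + 4) * ((α + η) ^ 2 / m ^ 2 + (ω + η) ^ 2) := by gcongr <;> linarith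
      _ = _ := by rw [hm2]; field_simp; ring
  have h2 := le_of_abs_le (abs_le_of_sq_le_sq h1 (by positivity))
  have h3 : (M + 2) * η = δ := by rw [hη]; field_simp
  linarith

/-- A gradient split into an arbitrary part `a` and a part `A w` in the range: the iterate pays
`M ≥ ‖A†‖` for the former and only an absolute constant for the latter. -/
lemma norm_le_of_eq_add_apply (hA : A.toLinearMap.IsSymmetric) {M : ℝ} (hM0 : 0 < M)
    (hM : ‖pinv A‖ ≤ M) {g p : Vec d} {t : ℕ} {K : Submodule ℝ (Vec d)}
    (hK : IsRangeInvariantKrylov A g t K) (hp : p ∈ lsArgmin A g K) {a w : Vec d}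
    (hg : g = a + A w) : ‖p‖ ≤ M * ‖a‖ + 2 * ‖w‖ := by
  refine le_of_forall_weighted_sq_le hM0 (norm_nonneg _) (norm_nonneg _) fun m hm => ?_
  refine (norm_sq_le_sum_of_mem_lsArgmin hA hM hm hK hp).trans ?_
  calc _ ≤ ∑ i with eigenVal hA i ≠ 0, (M ^ 2 * m ^ 2 + 4) *
        (eigenCoord hA i a ^ 2 / m ^ 2 + eigenCoord hA i w ^ 2) := by
        refine Finset.sum_le_sum fun i _ => ?_
        rw [hg, map_add, eigenCoord_apply, div_mul_eq_mul_div, div_le_iff₀ (by positivity),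
          mul_assoc]
        refine mul_le_mul_of_nonneg_left ?_ (by positivity)
        -- the Cauchy-Schwarz inequality
        have e : (eigenCoord hA i a ^ 2 / m ^ 2 + eigenCoord hA i w ^ 2) *
            (m ^ 2 + eigenVal hA i ^ 2) =
            (eigenCoord hA i a + eigenVal hA i * eigenCoord hA i w) ^ 2 +
            (eigenVal hA i * eigenCoord hA i a / m - m * eigenCoord hA i w) ^ 2 := by
          field_simp; ring
        rw [e]
        linarith [sq_nonneg (eigenVal hA i * eigenCoord hA i a / m - m * eigenCoord hA i w)]
    _ = (M ^ 2 * m ^ 2 + 4) * ((∑ i with eigenVal hA i ≠ 0, eigenCoord hA i a ^ 2) / m ^ 2 +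
        ∑ i with eigenVal hA i ≠ 0, eigenCoord hA i w ^ 2) := by
        rw [← Finset.mul_sum, Finset.sum_add_distrib, Finset.sum_div]
    _ ≤ _ := by
        gcongr
        · exact sum_filter_eigenCoord_le hA a
        · exact sum_filter_eigenCoord_le hA w

/-- A lower bound for the nonzero eigenvalues bounds every iterate, whatever its order. -/
lemma mul_norm_le_of_le_abs_eigenVal (hA : A.toLinearMap.IsSymmetric) {c : ℝ} (hc : 0 ≤ c)
    (hcl : ∀ i, eigenVal hA i ≠ 0 → c ≤ |eigenVal hA i|) {g p : Vec d} {t : ℕ}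
    {K : Submodule ℝ (Vec d)} (hK : IsRangeInvariantKrylov A g t K) (hp : p ∈ lsArgmin A g K) :
    c * ‖p‖ ≤ ‖g‖ := by
  have h1 : ‖A p‖ ^ 2 ≤ ‖g‖ ^ 2 := by
    have h := inner_residual_eq_zero hp hp.1
    have e : g = (A p + g) - A p := by abel
    rw [e, norm_sub_sq_real, h]
    nlinarith [sq_nonneg ‖A p + g‖]
  have h2 : (c * ‖p‖) ^ 2 ≤ ‖A p‖ ^ 2 := by
    rw [mul_pow, norm_sq_eq_sum_eigenCoord hA, norm_sq_eq_sum_eigenCoord hA, Finset.mul_sum]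
    refine Finset.sum_le_sum fun i _ => ?_
    rw [eigenCoord_apply, mul_pow]
    by_cases hi : eigenVal hA i = 0
    · rw [eigenCoord_eq_zero_of_mem_krylov hA hK hp.1 hi]; simp
    · have := hcl i hi
      rw [← sq_abs (eigenVal hA i)]
      gcongr
  exact le_of_abs_le (abs_le_of_sq_le_sq (h2.trans h1) (norm_nonneg _))

lemma finrank_span_eigenBasis (hA : A.toLinearMap.IsSymmetric) (I : Finset (Fin d)) :
    Module.finrank ℝ (Submodule.span ℝ (Set.range fun i : I => eigenBasis hA i)) = I.card := by
  have h : LinearIndependent ℝ fun i : I => eigenBasis hA i :=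
    (eigenBasis hA).orthonormal.linearIndependent.comp _ Subtype.val_injective
  rw [finrank_span_eq_card h, Fintype.card_coe]

lemma eigenCoord_eq_zero_of_mem_span (hA : A.toLinearMap.IsSymmetric) {I : Finset (Fin d)}
    {v : Vec d} (hv : v ∈ Submodule.span ℝ (Set.range fun i : I => eigenBasis hA i)) {j : Fin d}
    (hj : j ∉ I) : eigenCoord hA j v = 0 := by
  have h : Submodule.span ℝ (Set.range fun i : I => eigenBasis hA i) ≤
      LinearMap.ker (eigenCoord hA j) := by
    rw [Submodule.span_le]
    rintro _ ⟨i, rfl⟩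
    have hij : j ≠ i := fun h => hj (h ▸ i.2)
    simp [eigenCoord, hij]
  exact h hv

lemma card_eigenVal_ne_zero_le_rankOf (hA : A.toLinearMap.IsSymmetric) :
    (Finset.univ.filter fun i => eigenVal hA i ≠ 0).card ≤ rankOf A := by
  rw [← finrank_span_eigenBasis hA]
  refine Submodule.finrank_mono ?_
  rw [Submodule.span_le]
  rintro _ ⟨⟨i, hi⟩, rfl⟩
  have hi' : eigenVal hA i ≠ 0 := by simpa using hi
  refine ⟨(eigenVal hA i)⁻¹ • eigenBasis hA i, ?_⟩
  simp only [ContinuousLinearMap.coe_coe, map_smul, apply_eigenBasis, smul_smul]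
  rw [inv_mul_cancel₀ hi', one_smul]

/-- Weyl's inequality for an acute perturbation, by dimension count: the eigenvectors of `A` with
small eigenvalue would span a subspace too large to avoid the range of `H`. -/
lemma le_abs_eigenVal_of_rank_eq (hA : A.toLinearMap.IsSymmetric) {H : Op d} {γ ε : ℝ}
    (hE : ‖A - H‖ ≤ ε) (hH : ∀ p ∈ rangeOf H, γ * ‖p‖ ≤ ‖H p‖)
    (hrank : rankOf H = rankOf A) {j : Fin d} (hj : eigenVal hA j ≠ 0) :
    γ - ε ≤ |eigenVal hA j| := by
  by_contra! hlt
  set c := |eigenVal hA j|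
  let I : Finset (Fin d) := Finset.univ.filter fun i => |eigenVal hA i| ≤ c
  let V := Submodule.span ℝ (Set.range fun i : I => eigenBasis hA i)
  -- `I` holds `j` and every index of a zero eigenvalue
  have hcard : d < I.card + rankOf H := by
    have h1 := card_eigenVal_ne_zero_le_rankOf hA
    have h2 : (insert j (Finset.univ.filter fun i => eigenVal hA i = 0)).card ≤ I.card := by
      refine Finset.card_le_card fun i hi => ?_
      rcases Finset.mem_insert.1 hi with rfl | hi
      · simp [I, c]
      · simp only [Finset.mem_filter, Finset.mem_univ, true_and] at hi
        simp [I, hi, c]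
    rw [Finset.card_insert_of_notMem (by simpa using hj)] at h2
    have h3 := Finset.card_filter_add_card_filter_not (s := (Finset.univ : Finset (Fin d)))
      (fun i => eigenVal hA i = 0)
    rw [Finset.card_univ, Fintype.card_fin] at h3
    simp only [ne_eq] at h1
    omega
  have hndis : ¬ Disjoint V (rangeOf H) := by
    intro hdis
    have h1 := Submodule.finrank_add_finrank_le_of_disjoint hdis
    rw [finrank_span_eigenBasis hA, finrank_euclideanSpace_fin] at h1
    unfold rankOf at hcard
    omega
  rw [Submodule.disjoint_def] at hndis
  push Not at hndis
  obtain ⟨v, hvV, hvH, hv0⟩ := hndis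
  have hAv : ‖A v‖ ≤ c * ‖v‖ := by
    refine le_of_abs_le (abs_le_of_sq_le_sq ?_ (by positivity))
    rw [mul_pow, norm_sq_eq_sum_eigenCoord hA, norm_sq_eq_sum_eigenCoord hA, Finset.mul_sum]
    refine Finset.sum_le_sum fun i _ => ?_
    rw [eigenCoord_apply, mul_pow]
    by_cases hi : i ∈ I
    · have hi' : |eigenVal hA i| ≤ c := by simpa [I] using hi
      rw [← sq_abs (eigenVal hA i)]
      gcongr
    · rw [eigenCoord_eq_zero_of_mem_span hA hvV hi]; simp
  have hdiff : ‖A v - H v‖ ≤ ε * ‖v‖ := (A - H).le_of_opNorm_le hE v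
  have hHv := hH v hvH
  have htri : ‖H v‖ ≤ ‖A v‖ + ‖A v - H v‖ := by
    have := norm_sub_le (A v) (A v - H v)
    rwa [sub_sub_cancel] at this
  have hpos : 0 < ‖v‖ := norm_pos_iff.2 hv0
  nlinarith

end Iterate

/-! ### The gradient and the Hessian -/

section Hessian

variable {d : ℕ} {f : Vec d → ℝ}

/-- Symmetry of the second derivative. -/
lemma hessian_isSymmetric (hf : TwiceDifferentiable f) (x : Vec d) :
    (hessian f x).toLinearMap.IsSymmetric := by
  let Φ := (InnerProductSpace.toDual ℝ (Vec d)).toContinuousLinearEquiv.toContinuousLinearMap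
  have h1 : ∀ y, HasFDerivAt f (Φ (∇ f y)) y := fun y =>
    (hf.1 y).hasGradientAt.hasFDerivAt
  have h2 : HasFDerivAt (fun y => Φ (∇ f y)) (Φ.comp (hessian f x)) x :=
    Φ.hasFDerivAt.comp x (hf.2 x).hasFDerivAt
  intro v w
  have h := second_derivative_symmetric h1 h2 v w
  change inner ℝ (hessian f x v) w = inner ℝ (hessian f x w) v at h
  change inner ℝ (hessian f x v) w = inner ℝ v (hessian f x w)
  rw [h, real_inner_comm]

/-- The null-space property bounds the part of the gradient outside the range of the Hessian, and
pseudo-inverse regularity bounds a preimage of the part inside. -/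
lemma exists_gradient_eq_add_hessian (hf : TwiceDifferentiable f) {γ ν : ℝ} (hγ : 0 < γ)
    (hν : 0 < ν) (hν1 : ν ≤ 1) (hreg : PseudoInverseRegular f γ)
    (hnull : GradientHessianNullSpace f ν) (x : Vec d) :
    ∃ n w : Vec d, ∇ f x = n + hessian f x w ∧ ‖n‖ ≤ Real.sqrt (1 - ν) * ‖∇ f x‖ ∧
      ‖w‖ ≤ ‖∇ f x‖ / γ := by
  set g := ∇ f x
  set H := hessian f x with hH
  set S := rangeOf H with hS
  have hsym : H.toLinearMap.IsSymmetric := hessian_isSymmetric hf x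
  have hpyth := S.norm_sq_eq_add_norm_sq_projection g
  have hsum := S.starProjection_add_starProjection_orthogonal g
  have hnn : ‖Sᗮ.orthogonalProjectionOnto g‖ ^ 2 ≤
    (1 - ν) / ν * ‖S.orthogonalProjectionOnto g‖ ^ 2 := hnull x
  have h1 : ‖Sᗮ.orthogonalProjectionOnto g‖ ^ 2 ≤ (1 - ν) * ‖g‖ ^ 2 := by
    rw [div_mul_eq_mul_div, le_div_iff₀ hν] at hnn
    rw [hpyth]
    linarith
  have h2 : ‖S.orthogonalProjectionOnto g‖ ≤ ‖g‖ := by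
    refine le_of_abs_le (abs_le_of_sq_le_sq ?_ (norm_nonneg _))
    rw [hpyth]; linarith [sq_nonneg ‖Sᗮ.orthogonalProjectionOnto g‖]
  obtain ⟨z, hz⟩ : ∃ z, H z = S.starProjection g := S.starProjection_apply_mem g
  have hz2 : H (S.starProjection z) = H z := by
    have h3 := S.starProjection_add_starProjection_orthogonal z
    have h4 : Sᗮ.starProjection z ∈ LinearMap.ker H.toLinearMap := by
      rw [← hsym.orthogonal_range]
      exact Sᗮ.starProjection_apply_mem z
    have h5 : H (Sᗮ.starProjection z) = 0 := h4
    conv_rhs => rw [← h3, map_add, h5, add_zero]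
  refine ⟨Sᗮ.starProjection g, S.starProjection z, ?_, ?_, ?_⟩
  · rw [hz2, hz, add_comm, hsum]
  · refine le_of_abs_le (abs_le_of_sq_le_sq ?_ (by positivity))
    rw [mul_pow, Real.sq_sqrt (by linarith)]
    exact h1
  · rw [le_div_iff₀ hγ, mul_comm]
    refine (hreg x _ (S.starProjection_apply_mem z)).trans ?_
    rw [← hH, hz2, hz]
    exact h2

end Hessian

end NewtonMR

theorem mainTheorem10 {d : ℕ} (f : NewtonMR.Vec d → ℝ)
    (hf : NewtonMR.TwiceDifferentiable f)
    (γ ν ε C : ℝ) (hγ : 0 < γ) (hν : 0 < ν) (hν1 : ν ≤ 1)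
    (hε : 0 < ε) (hεγ : ε < γ) (hC : 1 ≤ C)
    (hreg : NewtonMR.PseudoInverseRegular f γ)
    (hnull : NewtonMR.GradientHessianNullSpace f ν)
    (x : NewtonMR.Vec d)
    (E : NewtonMR.Op d) (hEsymm : E.toLinearMap.IsSymmetric) (hE : ‖E‖ ≤ ε)
    (H Ht : NewtonMR.Op d) (hH : H = NewtonMR.hessian f x) (hHt : Ht = H + E)
    (hpert : ‖NewtonMR.pinv Ht‖ ≤ C / ε)
    (t : ℕ) (ht1 : 1 ≤ t) (ht : t ≤ NewtonMR.rankOf Ht)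
    (K : Submodule ℝ (NewtonMR.Vec d))
    (hK : NewtonMR.IsRangeInvariantKrylov Ht (gradient f x) t K)
    (p : NewtonMR.Vec d) (hp : NewtonMR.IsMinresQLPIterate Ht (gradient f x) K p) :
    ‖p‖ ≤ 1 / NewtonMR.gammaTilde γ ν ε C * ‖gradient f x‖ ∧
      (NewtonMR.rankOf H = NewtonMR.rankOf Ht →
        ‖p‖ ≤ 1 / NewtonMR.gammaTildeAcute γ ε * ‖gradient f x‖) := by
  have hA : Ht.toLinearMap.IsSymmetric := by
    rw [hHt, hH]; exact (NewtonMR.hessian_isSymmetric hf x).add hEsymm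
  constructor
  · obtain ⟨n, w, hg, hn, hw⟩ :=
      NewtonMR.exists_gradient_eq_add_hessian hf hγ hν hν1 hreg hnull x
    -- `H w = Ht w - E w`, and the small vector `E w` joins the null-space part
    have hdec : gradient f x = (n - E w) + Ht w := by
      rw [hHt, hH, hg, add_apply]; abel
    have hCε : 0 < C / ε := by positivity
    have hb := NewtonMR.norm_le_of_eq_add_apply hA hCε hpert hK hp.1 hdec
    have hEw : ‖E w‖ ≤ ε * ‖w‖ := E.le_of_opNorm_le hE w
    have hna : ‖n - E w‖ ≤ Real.sqrt (1 - ν) * ‖gradient f x‖ + ε * (‖gradient f x‖ / γ) :=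
      (norm_sub_le _ _).trans (add_le_add hn (hEw.trans (by gcongr)))
    have hinv : 1 / γ ≤ 1 / (γ - ε) := one_div_le_one_div_of_le (by linarith) (by linarith)
    have hCγ : 1 / γ ≤ C / γ := by gcongr
    rw [NewtonMR.gammaTilde, one_div, inv_inv]
    calc ‖p‖ ≤ C / ε * (Real.sqrt (1 - ν) * ‖gradient f x‖ + ε * (‖gradient f x‖ / γ)) +
          2 * (‖gradient f x‖ / γ) := hb.trans (by gcongr)
      _ = (1 / γ + 1 / γ + C * (1 / γ + Real.sqrt (1 - ν) / ε)) * ‖gradient f x‖ := by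
        field_simp; ring
      _ ≤ (1 / (γ - ε) + C / γ + C * (1 / γ + Real.sqrt (1 - ν) / ε)) * ‖gradient f x‖ := by
        gcongr
      _ = _ := by ring
  · intro hrank
    have hc : 0 < γ - ε := by linarith
    have h := NewtonMR.mul_norm_le_of_le_abs_eigenVal hA hc.le
      (fun i hi => NewtonMR.le_abs_eigenVal_of_rank_eq hA
        (by rw [hHt, add_sub_cancel_left]; exact hE) (by rw [hH]; exact hreg x) hrank hi)
      hK hp.1
    rw [NewtonMR.gammaTildeAcute, one_div, inv_mul_eq_div, le_div_iff₀ hc, mul_comm]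
    exact h
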